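/- **Setting.** Consider a sequence of Gaussian regression problems with sample sizes $n\to\infty$ ($n$ may run through any sequence of positive integers). We observe $Y=(Y_1,\dots,Y_n)$, $Y_i=\mu_n(i/n)+\lambda_n(i/n)Z_i$, with $Z_1,\dots,Z_n$ i.i.d. $\mathcal N(0,1)$. Let $|I_n|=1/l_n$, where $l_n\ge 1$ is an integer dividing $n$, and $|I_n|\to0$; let $\mathcal A_n=\{((j-1)|I_n|,\,j|I_n|] : 1\le j\le l_n\}$, so that each interval in $\mathcal A_n$ contains exactly $n|I_n|$ of the design points $i/n$, $1\le i\le n$. Let $\sigma_0>0$ be fixed, $\Delta_n>0$, $\sigma_n>0$, $\kappa_n=\sigma_n/\sigma_0$. The hypothesis is $H_0:\ \mu_n\equiv0,\ \lambda_n\equiv\sigma_0$. The alternative $H_1^n$ is that $\mu_n=\Delta_n1_{I}$, $\lambda_n^2=\sigma_0^2+\sigma_n^21_{I}$ for some (unknown) $I\in\mathcal A_n$. For a test $\Phi:\mathbb R^n\to\{0,1\}$ (the value $1$ means rejection) put $\bar\alpha(\Phi)=P_{H_0}(\Phi(Y)=1)$ and $$\bar\beta(\Phi)=\sup_{I\in\mathcal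 A_n}P_{\mu_n=\Delta_n1_I,\ \lambda_n^2=\sigma_0^2+\sigma_n^21_I}(\Phi(Y)=0).$$ **The adaptive test.** For $A\in\mathcal A_n$ let $\hat\Delta_A=(n|I_n|)^{-1}\sum_{i:\,i/n\in A}Y_i$, and let $$T_n^*(Y)=\sup_{A\in\mathcal A_n}\Bigl(\frac{\kappa_n^2}{\sigma_0^2(\kappa_n^2+1)}\sum_{i:\,i/n\in A}(Y_i-\hat\Delta_A)^2+\frac1{\sigma_0^2\,n|I_n|}\Bigl(\sum_{i:\,i/n\in A}Y_i\Bigr)^2\Bigr).$$ For $\alpha\in(0,1]$ let $$c_{n,\alpha}^*=\frac{\kappa_n^2}{\kappa_n^2+1}(n|I_n|-1)+1+2\sqrt{\Bigl[\frac{\kappa_n^4}{(\kappa_n^2+1)^2}(n|I_n|-1)+1\Bigr]\log\frac1{\alpha|I_n|}}+2\log\frac1{\alpha|I_n|},$$ and let $\Phi_n^*(Y)=1$ if $T_n^*(Y)>c_{n,\alpha}^*$ and $\Phi_n^*(Y)=0$ otherwise. **Theorem.** Let $\varepsilon_n>0$ be any sequence with $\varepsilon_n\sqrt{-\log|I_n|}\to\infty$,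 and let $\alpha\in(0,1]$. Suppose that one of the following three situations holds, where $o(\cdot)$ and limits refer to $n\to\infty$. * **DMR:** $\kappa_n^2/\Delta_n\to0$ and $\kappa_n^2/\Delta_n=o(\varepsilon_n)$ (if $\kappa_n$ is bounded, the latter holds in particular when $1/\Delta_n=o(\varepsilon_n)$), and for all sufficiently large $n$ $$\sqrt{n|I_n|}\,\Delta_n\ge(\sqrt2\,\sigma_0+\varepsilon_n)\sqrt{-\log|I_n|}.$$ * **ER:** for some constant $c>0$, $\sigma_n^2=c\,\sigma_0\Delta_n(1+o(\varepsilon_n))$ and $\sigma_n^2=o(\varepsilon_n)$, and for all sufficiently large $n$ $$\sqrt{n|I_n|}\,\Delta_n\ge\Bigl(\sigma_0\frac{c+\sqrt{2+3c^2}}{1+c^2}+\varepsilon_n\Bigr)\sqrt{-\log|I_n|}.$$ * **DVR:** $\sigma_0\Delta_n=\sigma_n^2\theta_n$ with $\Delta_n,\sigma_n,\theta_n\to0$, $\sigma_n^2=o(\varepsilon_n)$, $\theta_n=o(\varepsilon_n)$, and for all sufficiently large $n$ $$\sqrt{n|I_n|}\,\Delta_n\ge\bigl((1+\sqrt3)\sigma_0+\varepsilon_n\bigr)\sqrt{-\log|I_n|}\;\theta_n.$$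 Then $$\limsup_{n\to\infty}\bar\alpha(\Phi_n^*)\le\alpha\qquad\text{and}\qquad\limsup_{n\to\infty}\bar\beta(\Phi_n^*)\le\alpha.$$ -/

import Mathlib

open Filter Topology MeasureTheory ProbabilityTheory Asymptotics

noncomputable section

namespace HBR

/-- The design point `i / n`, `i = 1, …, n`; the index `i : Fin n` stands for the number `i + 1`. -/
def designPoint (n : ℕ) (i : Fin n) : ℝ := ((i : ℝ) + 1) / (n : ℝ)

/-- The law on `ℝⁿ` of `Y = (Y_1, …, Y_n)`, where `Y_i = mu (i/n) + lam (i/n) * Z_i` and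
`Z_1, …, Z_n` are i.i.d. standard normal. -/
def regressionLaw (n : ℕ) (mu lam : ℝ → ℝ) : Measure (Fin n → ℝ) :=
  (Measure.pi fun _ : Fin n => gaussianReal 0 1).map
    fun z i => mu (designPoint n i) + lam (designPoint n i) * z i

/-- The bump function `x ↦ Δ 1_I(x)`. -/
def bumpMean (Δ : ℝ) (I : Set ℝ) : ℝ → ℝ := I.indicator fun _ => Δ

/-- The standard deviation function `lam`, where `lam² = σ₀² + σ² 1_I`. -/
def bumpSd (σ₀ σ : ℝ) (I : Set ℝ) (x : ℝ) : ℝ :=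
  Real.sqrt (σ₀ ^ 2 + I.indicator (fun _ => σ ^ 2) x)

/-- The law of `Y` under the null hypothesis `mu ≡ 0`, `lam ≡ σ₀`. -/
def nullLaw (n : ℕ) (σ₀ : ℝ) : Measure (Fin n → ℝ) :=
  regressionLaw n (fun _ => 0) fun _ => σ₀

/-- The law of `Y` when there is a bump on `I`: `mu = Δ 1_I`, `lam² = σ₀² + σ² 1_I`. -/
def bumpLaw (n : ℕ) (Δ σ₀ σ : ℝ) (I : Set ℝ) : Measure (Fin n → ℝ) :=
  regressionLaw n (bumpMean Δ I) (bumpSd σ₀ σ I)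

/-- The common length `|I| = 1 / l` of the `l` candidate intervals. -/
def intervalLength (l : ℕ) : ℝ := 1 / (l : ℝ)

/-- The candidate intervals `((j - 1)|I|, j|I|]`, `1 ≤ j ≤ l`, with `|I| = 1 / l`; the index
`j : Fin l` stands for the number `j + 1`. -/
def candidate (l : ℕ) (j : Fin l) : Set ℝ :=
  Set.Ioc ((j : ℝ) * intervalLength l) (((j : ℝ) + 1) * intervalLength l)

open Classical in
/-- The indices `i` with `i / n ∈ A`. -/
def window (n : ℕ) (A : Set ℝ) : Finset (Fin n) :=
  Finset.univ.filter fun i => designPoint n i ∈ A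

/-- The empirical mean `(n|I|)⁻¹ ∑_{i/n ∈ A} Y_i` on a candidate interval `A`, `|I| = 1 / l`. -/
def empiricalMean (n l : ℕ) (A : Set ℝ) (y : Fin n → ℝ) : ℝ :=
  ((n : ℝ) * intervalLength l)⁻¹ * ∑ i ∈ window n A, y i

/-- The local statistic on the candidate interval `A`. -/
def localStatistic (n l : ℕ) (σ₀ κ : ℝ) (A : Set ℝ) (y : Fin n → ℝ) : ℝ :=
  κ ^ 2 / (σ₀ ^ 2 * (κ ^ 2 + 1)) * ∑ i ∈ window n A, (y i - empiricalMean n l A y) ^ 2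
    + 1 / (σ₀ ^ 2 * ((n : ℝ) * intervalLength l)) * (∑ i ∈ window n A, y i) ^ 2

/-- The adaptive likelihood ratio statistic `T*`, a supremum over the `l` candidate intervals. -/
def adaptiveStatistic (n l : ℕ) (σ₀ κ : ℝ) (y : Fin n → ℝ) : ℝ :=
  ⨆ j : Fin l, localStatistic n l σ₀ κ (candidate l j) y

/-- The threshold `c*`. -/
def adaptiveThreshold (n l : ℕ) (κ α : ℝ) : ℝ :=
  κ ^ 2 / (κ ^ 2 + 1) * ((n : ℝ) * intervalLength l - 1) + 1
    + 2 * Real.sqrt ((κ ^ 4 / (κ ^ 2 + 1) ^ 2 * ((n : ℝ) * intervalLength l - 1) + 1)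
        * Real.log (1 / (α * intervalLength l)))
    + 2 * Real.log (1 / (α * intervalLength l))

open Classical in
/-- The adaptive test `Φ*`: it rejects (value `1`) if and only if `T* > c*`. -/
def adaptiveTest (n l : ℕ) (σ₀ κ α : ℝ) (y : Fin n → ℝ) : Fin 2 :=
  if adaptiveThreshold n l κ α < adaptiveStatistic n l σ₀ κ y then 1 else 0

/-- The probability of the type I error of a test `Φ`. -/
def typeIError (n : ℕ) (σ₀ : ℝ) (Φ : (Fin n → ℝ) → Fin 2) : ENNReal :=
  nullLaw n σ₀ {y | Φ y = 1}

/-- The type II error of a test `Φ`: the worst case over the `l` candidate positions of the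
bump. -/
def typeIIError (n l : ℕ) (Δ σ₀ σ : ℝ) (Φ : (Fin n → ℝ) → Fin 2) : ENNReal :=
  ⨆ j : Fin l, bumpLaw n Δ σ₀ σ (candidate l j) {y | Φ y = 0}

/-- `√(n|I|) Δ ≿ b √(-log |I|)`, for sequences: the inequality `≥` holds eventually. -/
def EventuallyAbove (n l : ℕ → ℕ) (Δ b : ℕ → ℝ) : Prop :=
  ∀ᶠ k in atTop,
    b k * Real.sqrt (-Real.log (intervalLength (l k)))
      ≤ Real.sqrt ((n k : ℝ) * intervalLength (l k)) * Δ k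

/-- Dominant mean regime, above the detection bound (`κ = σ / σ₀`). -/
def DominantMean (n l : ℕ → ℕ) (σ₀ : ℝ) (Δ σ ε : ℕ → ℝ) : Prop :=
  Tendsto (fun k => (σ k / σ₀) ^ 2 / Δ k) atTop (𝓝 0) ∧
  (fun k => (σ k / σ₀) ^ 2 / Δ k) =o[atTop] ε ∧
  EventuallyAbove n l Δ fun k => Real.sqrt 2 * σ₀ + ε k

/-- Equilibrium regime, above the detection bound. -/
def Equilibrium (n l : ℕ → ℕ) (σ₀ : ℝ) (Δ σ ε : ℕ → ℝ) : Prop :=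
  ∃ c : ℝ, 0 < c ∧
    (∃ r : ℕ → ℝ, r =o[atTop] ε ∧ ∀ k, σ k ^ 2 = c * σ₀ * Δ k * (1 + r k)) ∧
    (fun k => σ k ^ 2) =o[atTop] ε ∧
    EventuallyAbove n l Δ fun k =>
      σ₀ * ((c + Real.sqrt (2 + 3 * c ^ 2)) / (1 + c ^ 2)) + ε k

/-- Dominant variance regime, above the detection bound. -/
def DominantVariance (n l : ℕ → ℕ) (σ₀ : ℝ) (Δ σ ε : ℕ → ℝ) : Prop :=
  ∃ θ : ℕ → ℝ,
    (∀ k, σ₀ * Δ k = σ k ^ 2 * θ k) ∧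
    Tendsto Δ atTop (𝓝 0) ∧ Tendsto σ atTop (𝓝 0) ∧ Tendsto θ atTop (𝓝 0) ∧
    (fun k => σ k ^ 2) =o[atTop] ε ∧ θ =o[atTop] ε ∧
    EventuallyAbove n l Δ fun k => ((1 + Real.sqrt 3) * σ₀ + ε k) * θ k

end HBR

end

namespace HBR

open scoped ENNReal

/-! Write m for the number of points in a window, a = κ²/(κ²+1), D = Δ/σ₀, s² = -log|I|. Under the
null, a local statistic is a χ²_{m-1} + χ²_1 with independent summands, and the threshold is its
Laurent–Massart quantile at tail probability α|I|. `mixed_upper_tail` and a union bound over the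
1/|I| windows give level α for every n.

Under the alternative only the window carrying the bump matters. Up to a nonnegative square, its
statistic is a quadratic function with mean mκ² + mD², and `quadratic_lower_tail` controls its
downward deviations. With u² = mD² and b² = mκ⁴/(κ²+1), this mean exceeds the threshold by u² + b² -
2bs - 2s², up to lower order terms (`threshold_le`). Positivity of this quadratic reads s(b +
√(2u²+3b²)) ≤ u² + b², that is u ≥ s · `detectionSlope` (b/u).

The three detection constants are instances of this inequality: b/u near 0 gives √2, b/u near c
gives the equilibrium constant, and for negligible u it becomes b ≥ (1+√3)s. The surplus ε in the
hypotheses yields a margin of order ε s → ∞. It pays for replacing b/u by its limit, for the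
dependence of the threshold on α, and for fluctuations of order (1+κ)√(u²+b²). -/

/-! ### Exponential moments of Gaussian quadratic forms -/

theorem lintegral_exp_quadratic_gaussian (p q : ℝ) (hp : 2 * p < 1) :
    ∫⁻ z, ENNReal.ofReal (Real.exp (p * z ^ 2 + q * z)) ∂(gaussianReal 0 1) =
      ENNReal.ofReal ((Real.sqrt (1 - 2 * p))⁻¹ * Real.exp (q ^ 2 / (2 * (1 - 2 * p)))) := by
  have hr : 0 < 1 - 2 * p := by linarith
  obtain ⟨v, hvr⟩ : ∃ v : NNReal, (v : ℝ) = (1 - 2 * p)⁻¹ :=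
    ⟨⟨(1 - 2 * p)⁻¹, (inv_pos.2 hr).le⟩, rfl⟩
  have hv : v ≠ 0 := by
    rw [← NNReal.coe_ne_zero, hvr]
    exact (inv_pos.2 hr).ne'
  rw [gaussianReal_of_var_ne_zero _ one_ne_zero,
    lintegral_withDensity_eq_lintegral_mul _ (measurable_gaussianPDF _ _) (by fun_prop)]
  -- Completing the square: the tilted density is a multiple of the Gaussian density with mean
  -- q/(1-2p) and variance 1/(1-2p).
  have key : ∀ z : ℝ, (gaussianPDF 0 1 * fun z =>
      ENNReal.ofReal (Real.exp (p * z ^ 2 + q * z))) z =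
      ENNReal.ofReal ((Real.sqrt (1 - 2 * p))⁻¹ * Real.exp (q ^ 2 / (2 * (1 - 2 * p)))) *
        gaussianPDF (q / (1 - 2 * p)) v z := by
    intro z
    simp only [Pi.mul_apply, gaussianPDF]
    rw [← ENNReal.ofReal_mul (gaussianPDFReal_nonneg _ _ _), ← ENNReal.ofReal_mul (by positivity)]
    congr 1
    simp only [gaussianPDFReal, NNReal.coe_one, hvr, mul_one, sub_zero]
    rw [Real.sqrt_mul (by positivity) (1 - 2 * p)⁻¹, Real.sqrt_inv, mul_inv, inv_inv]
    have hs : Real.sqrt (1 - 2 * p) ≠ 0 := (Real.sqrt_pos.2 hr).ne'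
    have e : Real.exp (-z ^ 2 / 2) * Real.exp (p * z ^ 2 + q * z) =
        Real.exp (q ^ 2 / (2 * (1 - 2 * p))) *
          Real.exp (-(z - q / (1 - 2 * p)) ^ 2 / (2 * (1 - 2 * p)⁻¹)) := by
      rw [← Real.exp_add, ← Real.exp_add]
      congr 1
      field_simp
      ring
    calc _ = (Real.sqrt (2 * Real.pi))⁻¹ *
          (Real.exp (-z ^ 2 / 2) * Real.exp (p * z ^ 2 + q * z)) := by ring
      _ = _ := by
        rw [e]
        field_simp
  simp_rw [key]
  rw [lintegral_const_mul _ (measurable_gaussianPDF _ _), lintegral_gaussianPDF_eq_one _ hv,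
    mul_one]

/-- The standard Gaussian law on a finite product of lines. -/
noncomputable abbrev stdNormal (ι : Type*) [Fintype ι] : Measure (ι → ℝ) :=
  Measure.pi fun _ => gaussianReal 0 1

theorem lintegral_exp_sum_stdNormal {ι : Type*} [Fintype ι] (W : Finset ι) (p q : ℝ)
    (hp : 2 * p < 1) :
    ∫⁻ z, ENNReal.ofReal (Real.exp (p * ∑ i ∈ W, z i ^ 2 + q * ∑ i ∈ W, z i)) ∂(stdNormal ι) =
      ENNReal.ofReal
        (((Real.sqrt (1 - 2 * p))⁻¹ * Real.exp (q ^ 2 / (2 * (1 - 2 * p)))) ^ W.card) := by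
  have h1 : ∀ z : ι → ℝ,
      ENNReal.ofReal (Real.exp (p * ∑ i ∈ W, z i ^ 2 + q * ∑ i ∈ W, z i)) =
      ∏ i ∈ W, ENNReal.ofReal (Real.exp (p * z i ^ 2 + q * z i)) := by
    intro z
    rw [← ENNReal.ofReal_prod_of_nonneg (fun _ _ => (Real.exp_pos _).le), ← Real.exp_sum,
      Finset.sum_add_distrib, Finset.mul_sum, Finset.mul_sum]
  simp_rw [h1]
  have hind : iIndepFun (fun (i : ι) (z : ι → ℝ) =>
      ENNReal.ofReal (Real.exp (p * z i ^ 2 + q * z i))) (stdNormal ι) :=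
    iIndepFun_pi (X := fun _ x => ENNReal.ofReal (Real.exp (p * x ^ 2 + q * x)))
      (fun i => by fun_prop)
  have h2 := lintegral_prod_eq_prod_lintegral_of_indepFun W _ hind (fun i => by fun_prop)
  rw [h2]
  have h3 : ∀ i : ι, ∫⁻ z, ENNReal.ofReal (Real.exp (p * z i ^ 2 + q * z i)) ∂(stdNormal ι) =
      ENNReal.ofReal ((Real.sqrt (1 - 2 * p))⁻¹ * Real.exp (q ^ 2 / (2 * (1 - 2 * p)))) := by
    intro i
    rw [← lintegral_exp_quadratic_gaussian p q hp,
      ← (measurePreserving_eval (fun _ : ι => gaussianReal 0 1) i).lintegral_comp (by fun_prop)]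
  rw [Finset.prod_congr rfl (fun i _ => h3 i), Finset.prod_const, ENNReal.ofReal_pow (by positivity)]

/-- This is x ≤ sinh x at x = -log(1-2y). It makes χ² sub-gamma to the right, as needed for the
upper tail. -/
theorem inv_sqrt_le_exp {y : ℝ} (h0 : 0 ≤ y) (h1 : 2 * y < 1) :
    (Real.sqrt (1 - 2 * y))⁻¹ ≤ Real.exp (y + y ^ 2 / (1 - 2 * y)) := by
  have hr : 0 < 1 - 2 * y := by linarith
  rw [← Real.exp_log (inv_pos.2 (Real.sqrt_pos.2 hr)), Real.exp_le_exp, Real.log_inv,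
    Real.log_sqrt hr.le]
  have hx : 0 ≤ -Real.log (1 - 2 * y) := by
    have := Real.log_nonpos hr.le (by linarith)
    linarith
  have h2 := Real.self_le_sinh_iff.2 hx
  rw [Real.sinh_eq, neg_neg, Real.exp_neg, Real.exp_log hr] at h2
  have h3 : y + y ^ 2 / (1 - 2 * y) = ((1 - 2 * y)⁻¹ - (1 - 2 * y)) / 2 / 2 := by
    have e : (1 - 2 * y) * (1 - 2 * y)⁻¹ = 1 := mul_inv_cancel₀ hr.ne'
    rw [div_eq_mul_inv]
    linear_combination (-(1 + 2 * y) / 4) * e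
  rw [h3]
  linarith

/-- From log(1+x) ≥ 2x/(x+2) at x = 2y. The exponent has no denominator, so the lower tail of χ² is
sub-Gaussian. -/
theorem inv_sqrt_one_add_le_exp {y : ℝ} (h0 : 0 ≤ y) :
    (Real.sqrt (1 + 2 * y))⁻¹ ≤ Real.exp (-y + y ^ 2) := by
  have hr : 0 < 1 + 2 * y := by linarith
  rw [← Real.exp_log (inv_pos.2 (Real.sqrt_pos.2 hr)), Real.exp_le_exp, Real.log_inv,
    Real.log_sqrt hr.le]
  have h2 := Real.le_log_one_add_of_nonneg (x := 2 * y) (by linarith)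
  have h3 : 2 * y - 2 * y ^ 2 ≤ 2 * (2 * y) / (2 * y + 2) := by
    rw [le_div_iff₀ (by linarith)]
    nlinarith [pow_nonneg h0 3]
  linarith

/-- No rotation is needed to separate the degrees of freedom: the square (∑ z)² is linearised by an
auxiliary standard Gaussian w, since exp(β²S²/2) is the mean of exp(βwS). After exchanging the
integrals the coordinates factorise, and the remaining integral in w is Gaussian again. -/
theorem lintegral_exp_mixed_le {ι : Type*} [Fintype ι] (W : Finset ι) (hW : 0 < W.card)
    {a t : ℝ} (ha0 : 0 ≤ a) (ha1 : a ≤ 1) (ht0 : 0 ≤ t) (ht1 : 2 * t < 1) :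
    ∫⁻ z, ENNReal.ofReal (Real.exp (t * (a * ∑ i ∈ W, z i ^ 2 +
        (1 - a) / W.card * (∑ i ∈ W, z i) ^ 2))) ∂(stdNormal ι) ≤
      ENNReal.ofReal (Real.exp (t * (a * ((W.card : ℝ) - 1) + 1) +
        t ^ 2 * (a ^ 2 * ((W.card : ℝ) - 1) + 1) / (1 - 2 * t))) := by
  have hm : (0 : ℝ) < W.card := by exact_mod_cast hW
  have hta : t * a ≤ t := by nlinarith
  have hta0 : 0 ≤ t * a := by positivity
  have hr : 0 < 1 - 2 * (t * a) := by linarith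
  have hr1 : 0 < 1 - 2 * t := by linarith
  set β : ℝ := Real.sqrt (2 * t * (1 - a) / W.card) with hβ
  have hβ2 : β ^ 2 = 2 * t * (1 - a) / W.card := by
    rw [hβ, Real.sq_sqrt]
    have : 0 ≤ 1 - a := by linarith
    positivity
  have h1 : ∀ z : ι → ℝ, ENNReal.ofReal (Real.exp (t * (a * ∑ i ∈ W, z i ^ 2 +
        (1 - a) / W.card * (∑ i ∈ W, z i) ^ 2))) =
      ∫⁻ w, ENNReal.ofReal (Real.exp (t * a * ∑ i ∈ W, z i ^ 2 + β * w * ∑ i ∈ W, z i))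
        ∂(gaussianReal 0 1) := by
    intro z
    have h2 := lintegral_exp_quadratic_gaussian 0 (β * ∑ i ∈ W, z i) (by norm_num)
    have h3 : ∀ w : ℝ,
        ENNReal.ofReal (Real.exp (t * a * ∑ i ∈ W, z i ^ 2 + β * w * ∑ i ∈ W, z i)) =
        ENNReal.ofReal (Real.exp (t * a * ∑ i ∈ W, z i ^ 2)) *
          ENNReal.ofReal (Real.exp (0 * w ^ 2 + (β * ∑ i ∈ W, z i) * w)) := by
      intro w
      rw [← ENNReal.ofReal_mul (Real.exp_pos _).le, ← Real.exp_add]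
      congr 2
      ring
    simp_rw [h3]
    rw [lintegral_const_mul _ (by fun_prop), h2, ← ENNReal.ofReal_mul (Real.exp_pos _).le]
    simp only [mul_zero, sub_zero, Real.sqrt_one, inv_one, one_mul, mul_one, ← Real.exp_add]
    rw [mul_pow, hβ2]
    congr 2
    field_simp
  simp_rw [h1]
  rw [lintegral_lintegral_swap (by fun_prop)]
  have h4 : ∀ w : ℝ, ∫⁻ z, ENNReal.ofReal (Real.exp (t * a * ∑ i ∈ W, z i ^ 2 +
      β * w * ∑ i ∈ W, z i)) ∂(stdNormal ι) =
      ENNReal.ofReal ((Real.sqrt (1 - 2 * (t * a)))⁻¹ ^ W.card) *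
        ENNReal.ofReal (Real.exp (t * (1 - a) / (1 - 2 * (t * a)) * w ^ 2 + 0 * w)) := by
    intro w
    rw [lintegral_exp_sum_stdNormal W _ _ (by linarith), mul_pow, ← Real.exp_nat_mul,
      ENNReal.ofReal_mul (by positivity)]
    congr 3
    rw [mul_pow, hβ2]
    field_simp
    ring
  have hs : 1 - 2 * (t * (1 - a) / (1 - 2 * (t * a))) = (1 - 2 * t) / (1 - 2 * (t * a)) := by
    have : 1 - 2 * t * a ≠ 0 := by rw [mul_assoc]; exact hr.ne'
    field_simp
    ring
  have hs' : 2 * (t * (1 - a) / (1 - 2 * (t * a))) < 1 := by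
    have : 0 < (1 - 2 * t) / (1 - 2 * (t * a)) := by positivity
    linarith
  simp_rw [h4]
  rw [lintegral_const_mul _ (by fun_prop), lintegral_exp_quadratic_gaussian _ _ hs',
    ← ENNReal.ofReal_mul (by positivity), hs]
  apply ENNReal.ofReal_le_ofReal
  -- The w-integral trades one factor (1-2ta)^(-1/2) for (1-2t)^(-1/2), leaving k = m - 1 degrees of
  -- freedom of weight a and one of weight 1.
  obtain ⟨k, hk⟩ : ∃ k, W.card = k + 1 := ⟨W.card - 1, by omega⟩
  have hk' : (W.card : ℝ) - 1 = k := by rw [hk]; push_cast; ring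
  rw [hk', hk, Real.sqrt_div hr1.le]
  have hq : Real.sqrt (1 - 2 * (t * a)) ≠ 0 := (Real.sqrt_pos.2 hr).ne'
  have hq1 : Real.sqrt (1 - 2 * t) ≠ 0 := (Real.sqrt_pos.2 hr1).ne'
  calc _ = (Real.sqrt (1 - 2 * (t * a)))⁻¹ ^ k * (Real.sqrt (1 - 2 * t))⁻¹ := by
        rw [pow_succ]
        simp only [ne_eq, OfNat.ofNat_ne_zero, not_false_eq_true, zero_pow, zero_div,
          Real.exp_zero, mul_one]
        rw [inv_div, mul_assoc, ← mul_div_assoc, inv_mul_cancel₀ hq, one_div]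
    _ ≤ Real.exp (t * a + (t * a) ^ 2 / (1 - 2 * (t * a))) ^ k *
        Real.exp (t + t ^ 2 / (1 - 2 * t)) := by
        gcongr
        · exact inv_sqrt_le_exp hta0 (by linarith)
        · exact inv_sqrt_le_exp ht0 ht1
    _ = Real.exp (k * (t * a + (t * a) ^ 2 / (1 - 2 * (t * a))) + (t + t ^ 2 / (1 - 2 * t))) := by
        rw [← Real.exp_nat_mul, ← Real.exp_add]
    _ ≤ _ := by
        rw [Real.exp_le_exp]
        have h5 : (t * a) ^ 2 / (1 - 2 * (t * a)) ≤ (t * a) ^ 2 / (1 - 2 * t) := by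
          gcongr
        have h6 := mul_le_mul_of_nonneg_left h5 (Nat.cast_nonneg (α := ℝ) k)
        have h7 : t * (a * k + 1) + t ^ 2 * (a ^ 2 * k + 1) / (1 - 2 * t) =
          k * (t * a) + k * ((t * a) ^ 2 / (1 - 2 * t)) + (t + t ^ 2 / (1 - 2 * t)) := by ring
        rw [h7]
        linarith

/-! ### Chernoff bounds for both tails -/

theorem measure_le_of_exp_moment {Ω : Type*} [MeasurableSpace Ω] (μ : Measure Ω) {X : Ω → ℝ}
    (hX : Measurable X) {c A B : ℝ}
    (h : ∫⁻ ω, ENNReal.ofReal (Real.exp (X ω)) ∂μ ≤ ENNReal.ofReal (Real.exp A))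
    (hB : A - c ≤ B) :
    μ {ω | c ≤ X ω} ≤ ENNReal.ofReal (Real.exp B) := by
  have h1 := mul_meas_ge_le_lintegral (μ := μ) (f := fun ω => ENNReal.ofReal (Real.exp (X ω)))
    (by fun_prop) (ENNReal.ofReal (Real.exp c))
  have h2 : {ω | c ≤ X ω} ⊆
      {ω | ENNReal.ofReal (Real.exp c) ≤ ENNReal.ofReal (Real.exp (X ω))} := fun ω hω =>
    ENNReal.ofReal_le_ofReal (Real.exp_le_exp.2 hω)
  have h3 : ENNReal.ofReal (Real.exp c) * μ {ω | c ≤ X ω} ≤ ENNReal.ofReal (Real.exp A) :=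
    (mul_le_mul_right (measure_mono h2) _).trans (h1.trans h)
  calc μ {ω | c ≤ X ω} = ENNReal.ofReal (Real.exp (-c)) *
        (ENNReal.ofReal (Real.exp c) * μ {ω | c ≤ X ω}) := by
        rw [← mul_assoc, ← ENNReal.ofReal_mul (Real.exp_pos _).le, ← Real.exp_add]
        simp
    _ ≤ ENNReal.ofReal (Real.exp (-c)) * ENNReal.ofReal (Real.exp A) := by gcongr
    _ = ENNReal.ofReal (Real.exp (A - c)) := by
        rw [← ENNReal.ofReal_mul (Real.exp_pos _).le, ← Real.exp_add]
        congr 2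
        ring
    _ ≤ _ := ENNReal.ofReal_le_ofReal (Real.exp_le_exp.2 hB)

/-- Upper tail of a weighted chi-square statistic. -/
theorem mixed_upper_tail {ι : Type*} [Fintype ι] (W : Finset ι) (hW : 0 < W.card)
    {a x : ℝ} (ha0 : 0 ≤ a) (ha1 : a ≤ 1) (hx : 0 ≤ x) :
    stdNormal ι {z | a * ((W.card : ℝ) - 1) + 1 +
        2 * Real.sqrt ((a ^ 2 * ((W.card : ℝ) - 1) + 1) * x) + 2 * x ≤
      a * ∑ i ∈ W, z i ^ 2 + (1 - a) / W.card * (∑ i ∈ W, z i) ^ 2} ≤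
      ENNReal.ofReal (Real.exp (-x)) := by
  have hm : (1 : ℝ) ≤ W.card := by exact_mod_cast hW
  set V : ℝ := a ^ 2 * ((W.card : ℝ) - 1) + 1 with hV
  have hV0 : 0 < V := by
    have : 0 ≤ a ^ 2 * ((W.card : ℝ) - 1) := mul_nonneg (sq_nonneg a) (by linarith)
    linarith
  set p := Real.sqrt V with hp
  set q := Real.sqrt x with hq
  have hp0 : 0 < p := Real.sqrt_pos.2 hV0
  have hq0 : 0 ≤ q := Real.sqrt_nonneg x
  have hpV : V = p ^ 2 := (Real.sq_sqrt hV0.le).symm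
  have hqx : x = q ^ 2 := (Real.sq_sqrt hx).symm
  rw [Real.sqrt_mul hV0.le, ← hp, ← hq]
  rcases hq0.eq_or_lt with h0 | hqpos
  · have : x = 0 := by rw [hqx, ← h0]; ring
    rw [this]
    simpa using prob_le_one
  -- The minimiser of t²p²/(1-2t) - t(2pq + 2q²); the minimum is exactly -q² = -x.
  set t := q / (p + 2 * q) with ht
  have ht0 : 0 < t := by positivity
  have ht1 : 1 - 2 * t = p / (p + 2 * q) := by rw [ht]; field_simp; ring
  have ht2 : 2 * t < 1 := by
    have : 0 < p / (p + 2 * q) := by positivity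
    linarith
  have h := measure_le_of_exp_moment (stdNormal ι) (B := -x)
    (c := t * (a * ((W.card : ℝ) - 1) + 1 + 2 * (p * q) + 2 * x)) (by fun_prop)
    (lintegral_exp_mixed_le W hW ha0 ha1 ht0.le ht2) (by
      rw [← hV, ht1, hpV, hqx, ht]
      have : q / (p + 2 * q) * (a * ((W.card : ℝ) - 1) + 1) +
          (q / (p + 2 * q)) ^ 2 * p ^ 2 / (p / (p + 2 * q)) -
          q / (p + 2 * q) * (a * ((W.card : ℝ) - 1) + 1 + 2 * (p * q) + 2 * q ^ 2) = - q ^ 2 := by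
        field_simp
        ring
      exact this.le)
  refine le_trans (measure_mono fun z hz => ?_) h
  exact mul_le_mul_of_nonneg_left hz ht0.le

/-- Lower tail of a noncentral quadratic statistic. -/
theorem quadratic_lower_tail {ι : Type*} [Fintype ι] (W : Finset ι) {e d g V : ℝ} (he : 0 ≤ e)
    (hg : 0 ≤ g) (hV : W.card * (e ^ 2 + d ^ 2 / 2) ≤ V) (hV0 : 0 < V) :
    stdNormal ι {z | e * ∑ i ∈ W, z i ^ 2 + d * ∑ i ∈ W, z i ≤ W.card * e - g} ≤
      ENNReal.ofReal (Real.exp (-(g ^ 2 / (4 * V)))) := by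
  -- The minimiser of t²V - tg.
  set t := g / (2 * V) with ht
  have ht0 : 0 ≤ t := by positivity
  have hte : 0 ≤ t * e := by positivity
  have h := measure_le_of_exp_moment (stdNormal ι) (B := -(g ^ 2 / (4 * V)))
    (X := fun z => -(t * e) * ∑ i ∈ W, z i ^ 2 + (-(t * d)) * ∑ i ∈ W, z i)
    (A := W.card * (-(t * e) + (t * e) ^ 2 + (t * d) ^ 2 / 2))
    (c := -(t * (W.card * e - g))) (by fun_prop) (by
      rw [lintegral_exp_sum_stdNormal W _ _ (by linarith), Real.exp_nat_mul]
      apply ENNReal.ofReal_le_ofReal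
      gcongr
      rw [Real.exp_add]
      have h1 : 1 - 2 * -(t * e) = 1 + 2 * (t * e) := by ring
      rw [h1, neg_sq]
      gcongr
      · exact inv_sqrt_one_add_le_exp hte
      · linarith) (by
      have h2 : (W.card : ℝ) * (-(t * e) + (t * e) ^ 2 + (t * d) ^ 2 / 2) -
        -(t * (W.card * e - g)) = t ^ 2 * (W.card * (e ^ 2 + d ^ 2 / 2)) - t * g := by ring
      have h3 : -(g ^ 2 / (4 * V)) = t ^ 2 * V - t * g := by
        rw [ht]
        field_simp
        ring
      rw [h2, h3]
      gcongr)
  refine le_trans (measure_mono fun z hz => ?_) h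
  have := mul_le_mul_of_nonneg_left hz ht0
  simp only [Set.mem_ofPred_eq] at this ⊢
  linarith

/-! ### The detection boundary as a quadratic inequality -/

/-- The detection constant as a function of the ratio of the variance signal to the mean signal. -/
noncomputable def detectionSlope (q : ℝ) : ℝ := (q + Real.sqrt (2 + 3 * q ^ 2)) / (1 + q ^ 2)

/-- The constant 9 is 3 + 6: the numerator varies with slope at most 1 + 2, and `hN` bounds the
effect of the changing denominator by 6. -/
theorem detectionSlope_le {q c : ℝ} (hq : 0 ≤ q) (hc : 0 ≤ c) :
    detectionSlope q ≤ detectionSlope c + 9 * |q - c| := by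
  unfold detectionSlope
  set A := Real.sqrt (2 + 3 * q ^ 2) with hA
  set B := Real.sqrt (2 + 3 * c ^ 2) with hB
  have hA2 : A ^ 2 = 2 + 3 * q ^ 2 := Real.sq_sqrt (by positivity)
  have hB2 : B ^ 2 = 2 + 3 * c ^ 2 := Real.sq_sqrt (by positivity)
  have hB0 : 0 ≤ B := Real.sqrt_nonneg _
  have hB1 : B ≤ 2 * (1 + c) := abs_le_of_sq_le_sq' (by nlinarith) (by linarith) |>.2
  set d := |q - c| with hd
  have hd0 : 0 ≤ d := abs_nonneg _
  have hd1 : q - c ≤ d := le_abs_self _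
  have hd2 : c - q ≤ d := by rw [hd, abs_sub_comm]; exact le_abs_self _
  have hcB : 3 / 2 * c ≤ B := by
    apply Real.le_sqrt_of_sq_le
    nlinarith
  have hAB : A ≤ B + 2 * d := by
    refine abs_le_of_sq_le_sq' ?_ (by linarith) |>.2
    have h1 : q ^ 2 ≤ (c + d) ^ 2 := by gcongr; linarith
    nlinarith [mul_le_mul_of_nonneg_right hcB hd0]
  have hN : (c + B) * (c + q) ≤ 6 * ((1 + q ^ 2) * (1 + c ^ 2)) := by
    have h1 : (c + B) * (c + q) ≤ (3 * (1 + c)) * (c + q) := by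
      gcongr
      linarith
    nlinarith [sq_nonneg (c - 1), sq_nonneg (q - 1), sq_nonneg (c - q), sq_nonneg (c * q)]
  rw [div_add' _ _ _ (by positivity), div_le_div_iff₀ (by positivity) (by positivity)]
  have h2 : (q + A) * (1 + c ^ 2) ≤ (c + B + 3 * d) * (1 + c ^ 2) :=
    mul_le_mul_of_nonneg_right (by linarith) (by positivity)
  have h3 : (c + B) * (c + q) * (c - q) ≤ 6 * ((1 + q ^ 2) * (1 + c ^ 2)) * d :=
    calc (c + B) * (c + q) * (c - q) ≤ (c + B) * (c + q) * d := by gcongr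
      _ ≤ _ := by gcongr
  have h4 : 0 ≤ d * (1 + c ^ 2) * q ^ 2 := by positivity
  nlinarith

/-- Multiply the hypothesis by (u²+b²)/u; the margin K only grows to at least K√(u²+b²), because u ≤
√(u²+b²). -/
theorem core_of_slope {u b s K : ℝ} (hu : 0 < u) (hb : 0 ≤ b) (hK : 0 ≤ K)
    (h : s * detectionSlope (b / u) + K ≤ u) :
    s * (b + Real.sqrt (2 * u ^ 2 + 3 * b ^ 2)) + K * Real.sqrt (u ^ 2 + b ^ 2) ≤
      u ^ 2 + b ^ 2 := by
  have h1 : detectionSlope (b / u) =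
      u * (b + Real.sqrt (2 * u ^ 2 + 3 * b ^ 2)) / (u ^ 2 + b ^ 2) := by
    have e : 2 * u ^ 2 + 3 * b ^ 2 = u ^ 2 * (2 + 3 * (b / u) ^ 2) := by field_simp
    rw [detectionSlope, e, Real.sqrt_mul (sq_nonneg u), Real.sqrt_sq hu.le]
    field_simp
  set R := Real.sqrt (u ^ 2 + b ^ 2) with hR
  have hR2 : R ^ 2 = u ^ 2 + b ^ 2 := Real.sq_sqrt (by positivity)
  have huR : u ≤ R := Real.le_sqrt_of_sq_le (by nlinarith)
  have hR0 : 0 < R := hu.trans_le huR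
  rw [h1, ← hR2] at h
  rw [← hR2]
  set T := Real.sqrt (2 * u ^ 2 + 3 * b ^ 2)
  have h2 : s * (u * (b + T)) + K * R ^ 2 ≤ u * R ^ 2 := by
    have h3 := mul_le_mul_of_nonneg_right h (sq_nonneg R)
    have h4 : (s * (u * (b + T) / R ^ 2) + K) * R ^ 2 = s * (u * (b + T)) + K * R ^ 2 := by
      field_simp
    linarith
  have h5 : K * R * u ≤ K * R * R := by gcongr
  have h6 : u * (s * (b + T) + K * R) ≤ u * R ^ 2 := by nlinarith
  exact le_of_mul_le_mul_left h6 hu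

/-- With R = √(u²+b²), both b ≤ R and √(2u²+3b²) ≤ √3 R hold, so the variance signal suffices alone,
however small u is. -/
theorem core_of_variance {u b s K : ℝ} (hs : 0 ≤ s)
    (h : (1 + Real.sqrt 3) * s + K ≤ b) :
    s * (b + Real.sqrt (2 * u ^ 2 + 3 * b ^ 2)) + K * Real.sqrt (u ^ 2 + b ^ 2) ≤
      u ^ 2 + b ^ 2 := by
  set R := Real.sqrt (u ^ 2 + b ^ 2) with hR
  have hR2 : R ^ 2 = u ^ 2 + b ^ 2 := Real.sq_sqrt (by positivity)
  have hbR : b ≤ R := Real.le_sqrt_of_sq_le (by nlinarith)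
  have hR0 : 0 ≤ R := Real.sqrt_nonneg _
  have hT : Real.sqrt (2 * u ^ 2 + 3 * b ^ 2) ≤ Real.sqrt 3 * R := by
    rw [hR, ← Real.sqrt_mul (by norm_num)]
    exact Real.sqrt_le_sqrt (by nlinarith)
  rw [← hR2]
  have h1 : s * (b + Real.sqrt (2 * u ^ 2 + 3 * b ^ 2)) ≤ s * (R + Real.sqrt 3 * R) := by
    gcongr
  have h2 := mul_le_mul_of_nonneg_right (h.trans hbR) hR0
  nlinarith

/-- The distance between the threshold and the mean of the statistic under the alternative. -/
theorem threshold_le {m κ D u b s w M : ℝ} (hm : 1 ≤ m) (hκ : 0 ≤ κ) (hu : 0 < u)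
    (hb : 0 ≤ b) (hs : 0 ≤ s) (hw : 0 ≤ w) (hM : 0 ≤ M) (hu2 : u ^ 2 = m * D ^ 2)
    (hb2 : b ^ 2 = m * κ ^ 4 / (κ ^ 2 + 1))
    (h : s * (b + Real.sqrt (2 * u ^ 2 + 3 * b ^ 2)) +
      (2 * M + 3 + 4 * w + 2 * w ^ 2) * (1 + κ) * Real.sqrt (u ^ 2 + b ^ 2) ≤ u ^ 2 + b ^ 2) :
    κ ^ 2 / (κ ^ 2 + 1) * (m - 1) + 1 +
      2 * Real.sqrt ((κ ^ 4 / (κ ^ 2 + 1) ^ 2 * (m - 1) + 1) * (s ^ 2 + w ^ 2)) +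
      2 * (s ^ 2 + w ^ 2) ≤
    m * κ ^ 2 + m * D ^ 2 - 2 * M * (1 + κ) * Real.sqrt (u ^ 2 + b ^ 2) := by
  set R := Real.sqrt (u ^ 2 + b ^ 2) with hR
  have hR2 : R ^ 2 = u ^ 2 + b ^ 2 := Real.sq_sqrt (by positivity)
  have huR : u ≤ R := Real.le_sqrt_of_sq_le (by nlinarith)
  have hbR : b ≤ R := Real.le_sqrt_of_sq_le (by nlinarith)
  have hR0 : 0 < R := hu.trans_le huR
  set T := Real.sqrt (2 * u ^ 2 + 3 * b ^ 2) with hT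
  have hT2 : T ^ 2 = 2 * R ^ 2 + b ^ 2 := by
    rw [hR2, hT, Real.sq_sqrt (by positivity)]
    ring
  have hT0 : 0 ≤ T := Real.sqrt_nonneg _
  have hTR : R ≤ T := abs_le_of_sq_le_sq' (by nlinarith) hT0 |>.2
  set K := (2 * M + 3 + 4 * w + 2 * w ^ 2) * (1 + κ) with hK
  have hK3 : 3 ≤ K := by
    rw [hK]
    nlinarith [mul_nonneg hM hκ, mul_nonneg hw hκ, mul_nonneg (sq_nonneg w) hκ, sq_nonneg w]
  rw [← hR2] at h
  have hsb : 0 ≤ s * b := by positivity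
  have hR1 : 1 ≤ R := by
    have h1 : K * R ≤ R * R := by nlinarith [mul_nonneg hs hT0]
    have := le_of_mul_le_mul_right h1 hR0
    linarith
  have hsR : s ≤ R := by
    have h1 : s * R ≤ R * R := by
      nlinarith [mul_le_mul_of_nonneg_left hTR hs, mul_nonneg (show 0 ≤ K by linarith) hR0.le]
    exact le_of_mul_le_mul_right h1 hR0
  -- Since T² - b² = 2R², the quadratic factorises after multiplication by R², and the hypothesis
  -- bounds the factor R² - s(b+T) from below. The other factor is at least R².
  have hF : K * R ≤ R ^ 2 - 2 * b * s - 2 * s ^ 2 := by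
    have h1 : K * R * R ^ 2 ≤ (R ^ 2 - 2 * b * s - 2 * s ^ 2) * R ^ 2 := by
      have h2 : (R ^ 2 - 2 * b * s - 2 * s ^ 2) * R ^ 2 =
          (R ^ 2 - s * (b + T)) * (R ^ 2 + s * (T - b)) := by
        linear_combination s ^ 2 * hT2
      have h3 : 0 ≤ s * (T - b) := mul_nonneg hs (by linarith [hbR.trans hTR])
      have h4 : K * R ≤ R ^ 2 - s * (b + T) := by linarith
      have h5 : 0 ≤ K * R := by positivity
      rw [h2]
      nlinarith [mul_nonneg h5 h3, mul_nonneg (sub_nonneg.2 h4) (by positivity : 0 ≤ R ^ 2 + s * (T - b))]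
    exact le_of_mul_le_mul_right h1 (by positivity)
  have hsq : Real.sqrt ((κ ^ 4 / (κ ^ 2 + 1) ^ 2 * (m - 1) + 1) * (s ^ 2 + w ^ 2)) ≤
      (b + 1) * (s + w) := by
    apply Real.sqrt_le_iff.2 ⟨by positivity, ?_⟩
    rw [mul_pow]
    have h1 : κ ^ 4 / (κ ^ 2 + 1) ^ 2 * (m - 1) ≤ b ^ 2 := by
      rw [hb2]
      have h0 : κ ^ 2 + 1 ≤ (κ ^ 2 + 1) ^ 2 := by
        have := sq_nonneg (κ ^ 2)
        have := sq_nonneg κ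
        linarith
      have h3 : κ ^ 4 / (κ ^ 2 + 1) ^ 2 ≤ κ ^ 4 / (κ ^ 2 + 1) :=
        div_le_div_of_nonneg_left (by positivity) (by positivity) h0
      calc κ ^ 4 / (κ ^ 2 + 1) ^ 2 * (m - 1) ≤ κ ^ 4 / (κ ^ 2 + 1) * m :=
            mul_le_mul h3 (by linarith) (by linarith) (by positivity)
        _ = _ := by ring
    refine mul_le_mul ?_ ?_ (by positivity) (by positivity)
    · rw [add_sq b]
      linarith
    · rw [add_sq s]
      linarith [mul_nonneg hs hw]
  have ha : κ ^ 2 / (κ ^ 2 + 1) ≤ 1 := by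
    rw [div_le_one (by positivity)]
    linarith
  have ha0 : 0 ≤ κ ^ 2 / (κ ^ 2 + 1) := by positivity
  -- The gain in mean from the variance bump is exactly b². The remaining terms 2bw, 2s, 2w, 2w² and
  -- 1 are absorbed in (3 + 4w + 2w²)R through b, s, 1 ≤ R.
  have e : m * κ ^ 2 - κ ^ 2 / (κ ^ 2 + 1) * m = b ^ 2 := by
    rw [hb2]
    field_simp
    ring
  have hKR : K * R = 2 * M * (1 + κ) * R + (3 + 4 * w + 2 * w ^ 2) * R +
      (3 + 4 * w + 2 * w ^ 2) * κ * R := by rw [hK]; ring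
  have h6 : 0 ≤ (3 + 4 * w + 2 * w ^ 2) * κ * R := by positivity
  have h7 : w * b ≤ w * R := by gcongr
  have h8 : w * 1 ≤ w * R := by gcongr
  have h9 : w ^ 2 * 1 ≤ w ^ 2 * R := by gcongr
  rw [mul_sub, ← hu2, mul_one]
  linarith

/-! ### Windows and the local statistic -/

theorem natCast_mul_intervalLength {n l : ℕ} (hl : 0 < l) (hdvd : l ∣ n) :
    (n : ℝ) * intervalLength l = ((n / l : ℕ) : ℝ) := by
  rw [intervalLength, Nat.cast_div hdvd (by exact_mod_cast hl.ne')]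
  ring

theorem card_window_candidate {n l : ℕ} (hn : 0 < n) (hl : 0 < l) (hdvd : l ∣ n) (j : Fin l) :
    (window n (candidate l j)).card = n / l := by
  obtain ⟨m, rfl⟩ := hdvd
  have hm : 0 < m := Nat.pos_of_mul_pos_left hn
  have hl' : (0 : ℝ) < l := by exact_mod_cast hl
  have hm' : (0 : ℝ) < m := by exact_mod_cast hm
  rw [Nat.mul_div_cancel_left _ hl]
  have hmem : ∀ i : Fin (l * m), i ∈ window (l * m) (candidate l j) ↔
      (j : ℕ) * m ≤ i ∧ (i : ℕ) < (j + 1) * m := by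
    intro i
    simp only [window, candidate, designPoint, intervalLength, Finset.mem_filter,
      Finset.mem_univ, true_and, Set.mem_Ioc, mul_one_div, Nat.cast_mul]
    rw [div_lt_div_iff₀ hl' (by positivity), div_le_div_iff₀ (by positivity) hl',
      show (j : ℝ) * (l * m) = (j * m) * l by ring,
      show ((j : ℝ) + 1) * (l * m) = ((j + 1) * m) * l by ring,
      mul_lt_mul_iff_left₀ hl', mul_le_mul_iff_left₀ hl']
    norm_cast
    omega
  have hj : ((j : ℕ) + 1) * m ≤ l * m := Nat.mul_le_mul_right m j.isLt
  have : (window (l * m) (candidate l j)).card =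
      (Finset.Ico ((j : ℕ) * m) ((j + 1) * m)).card := by
    refine Finset.card_bij (fun i _ => (i : ℕ)) (fun i hi => Finset.mem_Ico.2 ((hmem i).1 hi))
      (fun _ _ _ _ h => Fin.ext h) fun i hi => ?_
    rw [Finset.mem_Ico] at hi
    exact ⟨⟨i, hi.2.trans_le hj⟩, (hmem _).2 hi, rfl⟩
  rw [this, Nat.card_Ico, add_mul, one_mul, Nat.add_sub_cancel_left]

/-- Covers both hypotheses: D = 0, τ = σ₀ under the null, and D = Δ, τ = σ₀√(κ²+1) on the window of
the bump. -/
theorem localStatistic_of_affine {n l : ℕ} {σ₀ κ D τ : ℝ} {A : Set ℝ} {y z : Fin n → ℝ}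
    (hm : (n : ℝ) * intervalLength l = (window n A).card) (h0 : 0 < (window n A).card)
    (hy : ∀ i ∈ window n A, y i = D + τ * z i) :
    localStatistic n l σ₀ κ A y =
      κ ^ 2 / (σ₀ ^ 2 * (κ ^ 2 + 1)) * τ ^ 2 *
        (∑ i ∈ window n A, z i ^ 2 - (∑ i ∈ window n A, z i) ^ 2 / (window n A).card) +
      1 / (σ₀ ^ 2 * (window n A).card) *
        ((window n A).card * D + τ * ∑ i ∈ window n A, z i) ^ 2 := by
  have hM : ((window n A).card : ℝ) ≠ 0 := by exact_mod_cast h0.ne'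
  have h1 : ∑ i ∈ window n A, y i =
      (window n A).card * D + τ * ∑ i ∈ window n A, z i := by
    rw [Finset.sum_congr rfl hy, Finset.sum_add_distrib, ← Finset.mul_sum, Finset.sum_const,
      nsmul_eq_mul]
  have h2 : ∑ i ∈ window n A, (y i - empiricalMean n l A y) ^ 2 = τ ^ 2 *
      (∑ i ∈ window n A, z i ^ 2 - (∑ i ∈ window n A, z i) ^ 2 / (window n A).card) := by
    rw [empiricalMean, hm, h1]
    set S := ∑ i ∈ window n A, z i with hS
    have h3 : ∀ i ∈ window n A,
        (y i - ((window n A).card : ℝ)⁻¹ * ((window n A).card * D + τ * S)) ^ 2 =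
        τ ^ 2 * z i ^ 2 - 2 * τ ^ 2 * S / (window n A).card * z i +
          τ ^ 2 * S ^ 2 / (window n A).card ^ 2 := by
      intro i hi
      rw [hy i hi]
      field_simp
      ring
    rw [Finset.sum_congr rfl h3, Finset.sum_add_distrib, Finset.sum_sub_distrib,
      ← Finset.mul_sum, ← Finset.mul_sum, ← hS, Finset.sum_const, nsmul_eq_mul]
    field_simp
    ring
  rw [localStatistic, hm, h1, h2]
  ring

theorem measurable_localStatistic (n l : ℕ) (σ₀ κ : ℝ) (A : Set ℝ) :
    Measurable (localStatistic n l σ₀ κ A) := by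
  unfold localStatistic empiricalMean
  fun_prop

theorem regressionLaw_apply {n : ℕ} {mu lam : ℝ → ℝ} {s : Set (Fin n → ℝ)}
    (hs : MeasurableSet s) :
    regressionLaw n mu lam s =
      stdNormal (Fin n) {z | (fun i => mu (designPoint n i) + lam (designPoint n i) * z i) ∈ s} := by
  rw [regressionLaw, Measure.map_apply (by fun_prop) hs]
  rfl

theorem log_inv_mul_intervalLength {l : ℕ} (hl : 0 < l) {α : ℝ} (hα : 0 < α) :
    Real.log (1 / (α * intervalLength l)) = -Real.log (intervalLength l) + -Real.log α := by
  have : intervalLength l ≠ 0 := by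
    rw [intervalLength]
    positivity
  rw [one_div, Real.log_inv, Real.log_mul hα.ne' this]
  ring

theorem neg_log_intervalLength_nonneg (l : ℕ) : 0 ≤ -Real.log (intervalLength l) := by
  rw [intervalLength, one_div, Real.log_inv, neg_neg]
  exact Real.log_natCast_nonneg l

/-! ### Error bounds at a fixed sample size -/

theorem typeIError_adaptiveTest_le {n l : ℕ} (hn : 0 < n) (hl : 0 < l) (hdvd : l ∣ n)
    {σ₀ κ α : ℝ} (hσ₀ : 0 < σ₀) (hα : 0 < α) (hα1 : α ≤ 1) :
    typeIError n σ₀ (adaptiveTest n l σ₀ κ α) ≤ ENNReal.ofReal α := by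
  have : Nonempty (Fin l) := ⟨⟨0, hl⟩⟩
  have hl' : (0 : ℝ) < l := by exact_mod_cast hl
  set c := adaptiveThreshold n l κ α with hc
  set x := Real.log (1 / (α * intervalLength l)) with hx
  have hx0 : 0 ≤ x := by
    rw [hx, log_inv_mul_intervalLength hl hα]
    exact add_nonneg (neg_log_intervalLength_nonneg l)
      (neg_nonneg.2 (Real.log_nonpos hα.le hα1))
  have hexp : Real.exp (-x) = α / l := by
    rw [hx, one_div, Real.log_inv, neg_neg, Real.exp_log, intervalLength, mul_one_div]
    rw [intervalLength]
    positivity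
  have hj : ∀ j : Fin l, nullLaw n σ₀ {y | c ≤ localStatistic n l σ₀ κ (candidate l j) y} ≤
      ENNReal.ofReal (α / l) := by
    intro j
    have hcard := card_window_candidate hn hl hdvd j
    have hpos : 0 < (window n (candidate l j)).card := by
      rw [hcard]
      exact Nat.div_pos (Nat.le_of_dvd hn hdvd) hl
    have hm : (n : ℝ) * intervalLength l = (window n (candidate l j)).card := by
      rw [hcard, natCast_mul_intervalLength hl hdvd]
    rw [nullLaw, regressionLaw_apply (measurableSet_le measurable_const
      (measurable_localStatistic _ _ _ _ _)), ← hexp]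
    refine le_trans (measure_mono fun z hz => ?_)
      (mixed_upper_tail (window n (candidate l j)) hpos (a := κ ^ 2 / (κ ^ 2 + 1))
        (by positivity) (by rw [div_le_one (by positivity)]; linarith) hx0)
    simp only [Set.mem_ofPred_eq] at hz ⊢
    rw [localStatistic_of_affine (D := 0) (τ := σ₀) (z := z) hm hpos (fun i _ => rfl), hc,
      adaptiveThreshold, hm, ← hx] at hz
    have e1 : (κ ^ 2 / (κ ^ 2 + 1)) ^ 2 = κ ^ 4 / (κ ^ 2 + 1) ^ 2 := by
      rw [div_pow]
      ring
    rw [e1]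
    refine hz.trans_eq ?_
    have : ((window n (candidate l j)).card : ℝ) ≠ 0 := by exact_mod_cast hpos.ne'
    field_simp
    ring
  have hsub : {y | adaptiveTest n l σ₀ κ α y = 1} ⊆
      ⋃ j : Fin l, {y | c ≤ localStatistic n l σ₀ κ (candidate l j) y} := by
    intro y hy
    have h1 : c < adaptiveStatistic n l σ₀ κ y := by
      by_contra h
      simp [adaptiveTest, ← hc, h] at hy
    obtain ⟨j, hj⟩ := exists_lt_of_lt_ciSup h1
    exact Set.mem_iUnion.2 ⟨j, hj.le⟩
  calc typeIError n σ₀ (adaptiveTest n l σ₀ κ α)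
      ≤ ∑ j : Fin l, nullLaw n σ₀ {y | c ≤ localStatistic n l σ₀ κ (candidate l j) y} :=
        (measure_mono hsub).trans (measure_iUnion_fintype_le _ _)
    _ ≤ ∑ _j : Fin l, ENNReal.ofReal (α / l) := Finset.sum_le_sum fun j _ => hj j
    _ = ENNReal.ofReal α := by
        rw [Finset.sum_const, Finset.card_univ, Fintype.card_fin, nsmul_eq_mul,
          ← ENNReal.ofReal_natCast, ← ENNReal.ofReal_mul hl'.le, mul_div_cancel₀ _ hl'.ne']

theorem typeIIError_adaptiveTest_le {n l : ℕ} (hn : 0 < n) (hl : 0 < l) (hdvd : l ∣ n)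
    {Δ σ₀ σ α g V : ℝ} (hσ₀ : 0 < σ₀) (hg : 0 ≤ g) (hV0 : 0 < V)
    (hV : n * intervalLength l *
      ((σ / σ₀) ^ 4 + 2 * ((σ / σ₀) ^ 2 + 1) * (Δ / σ₀) ^ 2) ≤ V)
    (hthr : adaptiveThreshold n l (σ / σ₀) α ≤
      n * intervalLength l * (σ / σ₀) ^ 2 + n * intervalLength l * (Δ / σ₀) ^ 2 - g) :
    typeIIError n l Δ σ₀ σ (adaptiveTest n l σ₀ (σ / σ₀) α) ≤
      ENNReal.ofReal (Real.exp (-(g ^ 2 / (4 * V)))) := by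
  refine iSup_le fun j => ?_
  set c := adaptiveThreshold n l (σ / σ₀) α with hc
  set κ := σ / σ₀ with hκ
  set W := window n (candidate l j) with hW
  have hcard := card_window_candidate hn hl hdvd j
  have hpos : 0 < W.card := by
    rw [hW, hcard]
    exact Nat.div_pos (Nat.le_of_dvd hn hdvd) hl
  have hm : (n : ℝ) * intervalLength l = W.card := by
    rw [hW, hcard, natCast_mul_intervalLength hl hdvd]
  have hM : (0 : ℝ) < W.card := by exact_mod_cast hpos
  have hsub : {y | adaptiveTest n l σ₀ κ α y = 0} ⊆
      {y | localStatistic n l σ₀ κ (candidate l j) y ≤ c} := by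
    intro y hy
    have h1 : ¬ c < adaptiveStatistic n l σ₀ κ y := by
      intro h
      simp only [adaptiveTest, ← hc, Set.mem_ofPred_eq, if_pos h] at hy
      exact one_ne_zero hy
    exact (le_ciSup (Set.finite_range
      fun j : Fin l => localStatistic n l σ₀ κ (candidate l j) y).bddAbove j).trans (not_lt.1 h1)
  refine (measure_mono hsub).trans ?_
  rw [bumpLaw, regressionLaw_apply (measurableSet_le
      (measurable_localStatistic _ _ _ _ _) measurable_const)]
  set d := 2 * (Δ / σ₀) * Real.sqrt (κ ^ 2 + 1) with hd
  have hsq : Real.sqrt (κ ^ 2 + 1) ^ 2 = κ ^ 2 + 1 := Real.sq_sqrt (by positivity)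
  have hd2 : d ^ 2 / 2 = 2 * (κ ^ 2 + 1) * (Δ / σ₀) ^ 2 := by
    rw [hd, mul_pow, hsq]
    ring
  refine le_trans (measure_mono fun z hz => ?_)
    (quadratic_lower_tail W (e := κ ^ 2) (d := d) (g := g) (V := V) (by positivity) hg ?_ hV0)
  · simp only [Set.mem_ofPred_eq] at hz ⊢
    have hτ : Real.sqrt (σ₀ ^ 2 + σ ^ 2) = σ₀ * Real.sqrt (κ ^ 2 + 1) := by
      have e : σ₀ ^ 2 + σ ^ 2 = σ₀ ^ 2 * (κ ^ 2 + 1) := by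
        rw [hκ]
        field_simp
        ring
      rw [e, Real.sqrt_mul (sq_nonneg _), Real.sqrt_sq hσ₀.le]
    have hmem : ∀ i ∈ W, bumpMean Δ (candidate l j) (designPoint n i) +
        bumpSd σ₀ σ (candidate l j) (designPoint n i) * z i =
        Δ + σ₀ * Real.sqrt (κ ^ 2 + 1) * z i := by
      intro i hi
      have hi' : designPoint n i ∈ candidate l j := by
        simpa [hW, window] using hi
      rw [bumpMean, bumpSd, Set.indicator_of_mem hi', Set.indicator_of_mem hi', hτ]
    rw [localStatistic_of_affine hm hpos hmem, ← hW] at hz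
    set S := ∑ i ∈ W, z i with hS
    set Q := ∑ i ∈ W, z i ^ 2 with hQ
    have e : κ ^ 2 / (σ₀ ^ 2 * (κ ^ 2 + 1)) * (σ₀ * Real.sqrt (κ ^ 2 + 1)) ^ 2 *
          (Q - S ^ 2 / W.card) +
        1 / (σ₀ ^ 2 * W.card) * (W.card * Δ + σ₀ * Real.sqrt (κ ^ 2 + 1) * S) ^ 2 =
        κ ^ 2 * Q + d * S + W.card * (Δ / σ₀) ^ 2 + S ^ 2 / W.card := by
      have e1 : (W.card * Δ + σ₀ * Real.sqrt (κ ^ 2 + 1) * S) ^ 2 =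
          (W.card * Δ) ^ 2 + 2 * (W.card * Δ) * σ₀ * Real.sqrt (κ ^ 2 + 1) * S +
            σ₀ ^ 2 * (κ ^ 2 + 1) * S ^ 2 := by
        linear_combination σ₀ ^ 2 * S ^ 2 * hsq
      rw [e1, mul_pow, hsq, hd]
      have : κ ^ 2 + 1 ≠ 0 := by positivity
      field_simp
      ring
    rw [e] at hz
    -- Dropping this square costs only its mean, which is of order one, and leaves a sum of
    -- independent terms.
    have h2 : 0 ≤ S ^ 2 / W.card := by positivity
    rw [hm] at hthr
    linarith
  · rw [hd2, ← hm, ← pow_mul]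
    exact hV

/-- The strength of the mean signal on a candidate interval. -/
noncomputable def meanSignal (n l : ℕ) (σ₀ Δ : ℝ) : ℝ :=
  Real.sqrt (n * intervalLength l) * (Δ / σ₀)

/-- The strength of the variance signal on a candidate interval. -/
noncomputable def varianceSignal (n l : ℕ) (κ : ℝ) : ℝ :=
  Real.sqrt (n * intervalLength l) * κ ^ 2 / Real.sqrt (κ ^ 2 + 1)

/-- The scale `√(-log |I|)` of the maximal noise. -/
noncomputable def noiseScale (l : ℕ) : ℝ := Real.sqrt (-Real.log (intervalLength l))

/-- The signal with mean part `u` and variance part `b` exceeds the noise level `s` with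
margin `K`. -/
def SignalExceeds (u b s K : ℝ) : Prop :=
  s * (b + Real.sqrt (2 * u ^ 2 + 3 * b ^ 2)) + K * Real.sqrt (u ^ 2 + b ^ 2) ≤ u ^ 2 + b ^ 2

/-- The margin holds a deviation g = 2√2 w(1+κ)R against the variance proxy V = 2(1+κ)²R², so that
g²/(4V) = w² = -log α and the error bound is α itself. -/
theorem typeIIError_le_of_signalExceeds {n l : ℕ} (hn : 0 < n) (hl : 0 < l) (hdvd : l ∣ n)
    {Δ σ₀ σ α : ℝ} (hσ₀ : 0 < σ₀) (hΔ : 0 < Δ) (hσ : 0 < σ) (hα : 0 < α) (hα1 : α ≤ 1)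
    {w : ℝ} (hw : w = Real.sqrt (-Real.log α))
    (h : SignalExceeds (meanSignal n l σ₀ Δ) (varianceSignal n l (σ / σ₀)) (noiseScale l)
      ((2 * (Real.sqrt 2 * w) + 3 + 4 * w + 2 * w ^ 2) * (1 + σ / σ₀))) :
    typeIIError n l Δ σ₀ σ (adaptiveTest n l σ₀ (σ / σ₀) α) ≤ ENNReal.ofReal α := by
  set κ := σ / σ₀ with hκ
  have hκ0 : 0 < κ := by positivity
  have hm : (1 : ℝ) ≤ n * intervalLength l := by
    rw [natCast_mul_intervalLength hl hdvd]
    exact_mod_cast Nat.div_pos (Nat.le_of_dvd hn hdvd) hl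
  have hm0 : (0 : ℝ) < n * intervalLength l := by linarith
  set u := meanSignal n l σ₀ Δ with hu
  set b := varianceSignal n l κ with hb
  have hu0 : 0 < u := by rw [hu, meanSignal]; positivity
  have hb0 : 0 ≤ b := by rw [hb, varianceSignal]; positivity
  have hw0 : 0 ≤ w := hw ▸ Real.sqrt_nonneg _
  have hw2 : w ^ 2 = -Real.log α := by
    rw [hw, Real.sq_sqrt (neg_nonneg.2 (Real.log_nonpos hα.le hα1))]
  have hs2 : noiseScale l ^ 2 = -Real.log (intervalLength l) := by
    rw [noiseScale, Real.sq_sqrt (neg_log_intervalLength_nonneg l)]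
  have hu2 : u ^ 2 = n * intervalLength l * (Δ / σ₀) ^ 2 := by
    rw [hu, meanSignal, mul_pow, Real.sq_sqrt hm0.le]
  have hb2 : b ^ 2 = n * intervalLength l * κ ^ 4 / (κ ^ 2 + 1) := by
    rw [hb, varianceSignal, div_pow, mul_pow, Real.sq_sqrt hm0.le, Real.sq_sqrt (by positivity)]
    ring
  have hthr := threshold_le hm hκ0.le hu0 hb0 (Real.sqrt_nonneg _) hw0
    (mul_nonneg (Real.sqrt_nonneg 2) hw0) hu2 hb2 h
  set R := Real.sqrt (u ^ 2 + b ^ 2) with hR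
  have hR2 : R ^ 2 = u ^ 2 + b ^ 2 := Real.sq_sqrt (by positivity)
  have hR0 : 0 < R := Real.sqrt_pos.2 (by positivity)
  have h1 := typeIIError_adaptiveTest_le hn hl hdvd (Δ := Δ) (σ := σ) (α := α)
    (g := 2 * (Real.sqrt 2 * w) * (1 + κ) * R) (V := 2 * (1 + κ) ^ 2 * R ^ 2) hσ₀
    (by positivity) (by positivity) (by
      rw [← hκ, hR2]
      have e : n * intervalLength l * κ ^ 4 = b ^ 2 * (κ ^ 2 + 1) := by
        rw [hb2]
        field_simp
      calc _ = (κ ^ 2 + 1) * (b ^ 2 + 2 * u ^ 2) := by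
            rw [hu2]
            linear_combination e
        _ ≤ (1 + κ) ^ 2 * (2 * (u ^ 2 + b ^ 2)) := by
            gcongr
            · nlinarith
            · nlinarith
        _ = _ := by ring) (by
      rw [← hκ, adaptiveThreshold, log_inv_mul_intervalLength hl hα, ← hw2, ← hs2]
      exact hthr)
  refine h1.trans_eq ?_
  congr 1
  have e : (2 * (Real.sqrt 2 * w) * (1 + κ) * R) ^ 2 / (4 * (2 * (1 + κ) ^ 2 * R ^ 2)) =
      -Real.log α := by
    rw [← hw2, mul_pow, mul_pow, mul_pow, mul_pow, Real.sq_sqrt (by norm_num)]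
    field_simp
    ring
  rw [e, neg_neg, Real.exp_log hα]

/-! ### The three regimes -/

theorem tendsto_noiseScale {l : ℕ → ℕ} (hl : ∀ k, 0 < l k)
    (hI : Tendsto (fun k => intervalLength (l k)) atTop (𝓝 0)) :
    Tendsto (fun k => noiseScale (l k)) atTop atTop := by
  refine Real.tendsto_sqrt_atTop.comp (tendsto_neg_atBot_atTop.comp
    (Real.tendsto_log_nhdsGT_zero.comp (tendsto_nhdsWithin_iff.2
      ⟨hI, Eventually.of_forall fun k => ?_⟩)))
  have : (0 : ℝ) < l k := by exact_mod_cast hl k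
  rw [Set.mem_Ioi, intervalLength]
  positivity

theorem EventuallyAbove.meanSignal {n l : ℕ → ℕ} {Δ b : ℕ → ℝ} (h : EventuallyAbove n l Δ b)
    {σ₀ : ℝ} (hσ₀ : 0 < σ₀) :
    ∀ᶠ k in atTop, b k / σ₀ * noiseScale (l k) ≤ meanSignal (n k) (l k) σ₀ (Δ k) := by
  filter_upwards [h] with k hk
  rw [HBR.meanSignal, noiseScale, div_mul_eq_mul_div, ← mul_div_assoc]
  gcongr

theorem eventually_abs_le_of_isLittleO {f ε : ℕ → ℝ} (h : f =o[atTop] ε) (hε : ∀ k, 0 < ε k)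
    {δ : ℝ} (hδ : 0 < δ) : ∀ᶠ k in atTop, |f k| ≤ δ * ε k := by
  filter_upwards [h.def hδ] with k hk
  rwa [Real.norm_eq_abs, Real.norm_eq_abs, abs_of_pos (hε k)] at hk

theorem meanSignal_pos {n l : ℕ} (hn : 0 < n) (hl : 0 < l) {σ₀ Δ : ℝ} (hσ₀ : 0 < σ₀)
    (hΔ : 0 < Δ) : 0 < meanSignal n l σ₀ Δ := by
  have hn' : (0 : ℝ) < n := by exact_mod_cast hn
  have hl' : (0 : ℝ) < l := by exact_mod_cast hl
  rw [meanSignal, intervalLength]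
  positivity

theorem le_meanSignal {n l : ℕ} (hn : 0 < n) (hl : 0 < l) (hdvd : l ∣ n) {σ₀ Δ : ℝ}
    (hσ₀ : 0 < σ₀) (hΔ : 0 < Δ) : Δ / σ₀ ≤ meanSignal n l σ₀ Δ := by
  have hm : (1 : ℝ) ≤ n * intervalLength l := by
    rw [natCast_mul_intervalLength hl hdvd]
    exact_mod_cast Nat.div_pos (Nat.le_of_dvd hn hdvd) hl
  rw [meanSignal]
  exact le_mul_of_one_le_left (by positivity) (Real.one_le_sqrt.2 hm)

theorem varianceSignal_nonneg (n l : ℕ) (κ : ℝ) : 0 ≤ varianceSignal n l κ := by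
  rw [varianceSignal]
  positivity

theorem varianceSignal_div_meanSignal {n l : ℕ} (hn : 0 < n) (hl : 0 < l) (σ₀ Δ κ : ℝ) :
    varianceSignal n l κ / meanSignal n l σ₀ Δ = κ ^ 2 / (Δ / σ₀) / Real.sqrt (κ ^ 2 + 1) := by
  have hn' : (0 : ℝ) < n := by exact_mod_cast hn
  have hl' : (0 : ℝ) < l := by exact_mod_cast hl
  have : Real.sqrt (n * intervalLength l) ≠ 0 := by
    rw [intervalLength]
    positivity
  rw [varianceSignal, meanSignal]
  field_simp

theorem one_sub_sq_le_inv_sqrt (κ : ℝ) : 1 - κ ^ 2 ≤ (Real.sqrt (κ ^ 2 + 1))⁻¹ := by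
  have h1 : 1 ≤ Real.sqrt (κ ^ 2 + 1) := Real.one_le_sqrt.2 (by linarith [sq_nonneg κ])
  have h2 : Real.sqrt (κ ^ 2 + 1) ≤ κ ^ 2 + 1 := by
    rw [Real.sqrt_le_iff]
    constructor <;> nlinarith [sq_nonneg κ]
  rw [← one_div, le_div_iff₀ (by linarith)]
  rcases le_total (κ ^ 2) 1 with h | h
  · nlinarith [mul_le_mul_of_nonneg_left h2 (sub_nonneg.2 h), sq_nonneg (κ ^ 2)]
  · nlinarith

/-- Signals whose ratio of variance to mean part is close to `c`. -/
theorem eventually_signalExceeds_of_ratio {n l : ℕ → ℕ} (hn : ∀ k, 0 < n k) (hl : ∀ k, 0 < l k)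
    {σ₀ : ℝ} (hσ₀ : 0 < σ₀) {Δ κ ε : ℕ → ℝ} (hΔ : ∀ k, 0 < Δ k) (hκ : ∀ k, 0 < κ k)
    {c : ℝ} (hc : 0 ≤ c)
    (hq : ∀ δ > 0, ∀ᶠ k in atTop,
      |κ k ^ 2 / (Δ k / σ₀) / Real.sqrt (κ k ^ 2 + 1) - c| ≤ δ * ε k)
    (habove : EventuallyAbove n l Δ fun k => σ₀ * detectionSlope c + ε k)
    (hκs : ∀ K > 0, ∀ᶠ k in atTop, K * (1 + κ k) ≤
      meanSignal (n k) (l k) σ₀ (Δ k) - noiseScale (l k) * detectionSlope c)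
    {K : ℝ} (hK : 0 < K) :
    ∀ᶠ k in atTop, SignalExceeds (meanSignal (n k) (l k) σ₀ (Δ k))
      (varianceSignal (n k) (l k) (κ k)) (noiseScale (l k)) (K * (1 + κ k)) := by
  -- With the constant 9 of `detectionSlope_le`, replacing the ratio by c costs half of the surplus
  -- ε s/σ₀; the factor 2K reserves the other half for the margin.
  filter_upwards [hq (1 / (18 * σ₀)) (by positivity), habove.meanSignal hσ₀,
    hκs (2 * K) (by positivity)] with k h1 h2 h3
  have hκk := hκ k
  have hs : 0 ≤ noiseScale (l k) := Real.sqrt_nonneg _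
  refine core_of_slope (meanSignal_pos (hn k) (hl k) hσ₀ (hΔ k)) (varianceSignal_nonneg _ _ _)
    (by positivity) ?_
  rw [varianceSignal_div_meanSignal (hn k) (hl k)]
  set q := κ k ^ 2 / (Δ k / σ₀) / Real.sqrt (κ k ^ 2 + 1) with hqdef
  have hq0 : 0 ≤ q := by
    have := hΔ k
    rw [hqdef]
    positivity
  have h4 := mul_le_mul_of_nonneg_left (detectionSlope_le hq0 hc) hs
  have h5 := mul_le_mul_of_nonneg_left h1 hs
  have h6 : (σ₀ * detectionSlope c + ε k) / σ₀ * noiseScale (l k) =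
      noiseScale (l k) * detectionSlope c + 18 * (noiseScale (l k) * (1 / (18 * σ₀) * ε k)) := by
    field_simp
  nlinarith

theorem DominantMean.eventually_signalExceeds {n l : ℕ → ℕ} (hn : ∀ k, 0 < n k)
    (hl : ∀ k, 0 < l k) (hdvd : ∀ k, l k ∣ n k) {σ₀ : ℝ} (hσ₀ : 0 < σ₀) {Δ σ ε : ℕ → ℝ}
    (hΔ : ∀ k, 0 < Δ k) (hσ : ∀ k, 0 < σ k) (hε : ∀ k, 0 < ε k)
    (hεI : Tendsto (fun k => ε k * noiseScale (l k)) atTop atTop)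
    (h : DominantMean n l σ₀ Δ σ ε) {K : ℝ} (hK : 0 < K) :
    ∀ᶠ k in atTop, SignalExceeds (meanSignal (n k) (l k) σ₀ (Δ k))
      (varianceSignal (n k) (l k) (σ k / σ₀)) (noiseScale (l k)) (K * (1 + σ k / σ₀)) := by
  obtain ⟨h0, ho, habove⟩ := h
  have hslope : detectionSlope 0 = Real.sqrt 2 := by simp [detectionSlope]
  have habove' : EventuallyAbove n l Δ fun k => σ₀ * detectionSlope 0 + ε k := by
    simpa only [hslope, mul_comm σ₀] using habove
  refine eventually_signalExceeds_of_ratio hn hl hσ₀ hΔ (fun k => div_pos (hσ k) hσ₀) le_rfl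
    (fun δ hδ => ?_) habove' (fun K hK => ?_) hK
  · filter_upwards [eventually_abs_le_of_isLittleO ho hε (δ := δ / σ₀) (by positivity)] with k hk
    have := hΔ k
    have h1 : 1 ≤ Real.sqrt ((σ k / σ₀) ^ 2 + 1) :=
      Real.one_le_sqrt.2 (by linarith [sq_nonneg (σ k / σ₀)])
    rw [abs_of_nonneg (by positivity)] at hk
    rw [sub_zero, abs_of_nonneg (by positivity)]
    calc _ ≤ (σ k / σ₀) ^ 2 / (Δ k / σ₀) := div_le_self (by positivity) h1
      _ = (σ k / σ₀) ^ 2 / Δ k * σ₀ := by field_simp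
      _ ≤ δ / σ₀ * ε k * σ₀ := by gcongr
      _ = _ := by field_simp
  · filter_upwards [habove'.meanSignal hσ₀, h0.eventually_le_const (u := σ₀⁻¹) (by positivity),
      eventually_abs_le_of_isLittleO ho hε (δ := 1 / (2 * σ₀ ^ 2)) (by positivity),
      hεI.eventually_ge_atTop (σ₀ * (2 * K + 8 * K ^ 2))] with k h1 h2 h3 h4
    have hΔk := hΔ k
    have hσk := hσ k
    have hs : 0 ≤ noiseScale (l k) := Real.sqrt_nonneg _
    have hu := le_meanSignal (hn k) (hl k) (hdvd k) hσ₀ hΔk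
    set u := meanSignal (n k) (l k) σ₀ (Δ k)
    set s := noiseScale (l k)
    set κ := σ k / σ₀ with hκ
    have hκ0 : 0 < κ := by positivity
    rw [abs_of_nonneg (by positivity)] at h3
    set G := u - s * detectionSlope 0 with hG
    have e1 : (σ₀ * detectionSlope 0 + ε k) / σ₀ * s =
      s * detectionSlope 0 + ε k * s / σ₀ := by
      field_simp
    have hw : ε k * s / σ₀ ≤ G := by linarith
    have hw' : 2 * K + 8 * K ^ 2 ≤ ε k * s / σ₀ := by
      rw [le_div_iff₀ hσ₀]
      linarith
    -- κ may be unbounded here. Since Δ/σ₀ ≤ u = G + s√2, the smallness of κ²/Δ bounds κ² by the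
    -- surplus G, which then dominates a term linear in κ.
    have hκG : κ ^ 2 ≤ 2 * G := by
      have e2 : κ ^ 2 = κ ^ 2 / Δ k * σ₀ * (Δ k / σ₀) := by field_simp
      have h5 : κ ^ 2 ≤ κ ^ 2 / Δ k * σ₀ * u := by
        conv_lhs => rw [e2]
        gcongr
      have h6 : κ ^ 2 / Δ k * σ₀ ≤ 1 := by
        calc _ ≤ σ₀⁻¹ * σ₀ := by gcongr
          _ = 1 := inv_mul_cancel₀ hσ₀.ne'
      have h7 : κ ^ 2 / Δ k * σ₀ * (s * detectionSlope 0) ≤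
          (1 / (2 * σ₀ ^ 2) * ε k) * σ₀ * (s * 2) := by
        have h8 : Real.sqrt 2 ≤ 2 := by
          rw [Real.sqrt_le_iff]
          norm_num
        have hεk := hε k
        rw [hslope]
        gcongr
      have e3 : (1 / (2 * σ₀ ^ 2) * ε k) * σ₀ * (s * 2) = ε k * s / σ₀ := by field_simp
      have hG0 : 0 ≤ G := le_trans (by positivity) (hw'.trans hw)
      have h8 : κ ^ 2 / Δ k * σ₀ * G ≤ 1 * G := by gcongr
      have e4 : u = G + s * detectionSlope 0 := by rw [hG]; ring
      rw [e4] at h5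
      linarith
    have h9 : 2 * (K * κ) ≤ 4 * K ^ 2 + κ ^ 2 / 4 := by nlinarith [sq_nonneg (2 * K - κ / 2)]
    linarith [sq_nonneg K]

theorem Equilibrium.eventually_signalExceeds {n l : ℕ → ℕ} (hn : ∀ k, 0 < n k)
    (hl : ∀ k, 0 < l k) {σ₀ : ℝ} (hσ₀ : 0 < σ₀) {Δ σ ε : ℕ → ℝ}
    (hΔ : ∀ k, 0 < Δ k) (hσ : ∀ k, 0 < σ k) (hε : ∀ k, 0 < ε k)
    (hs : Tendsto (fun k => noiseScale (l k)) atTop atTop)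
    (hεI : Tendsto (fun k => ε k * noiseScale (l k)) atTop atTop)
    (h : Equilibrium n l σ₀ Δ σ ε) {K : ℝ} (hK : 0 < K) :
    ∀ᶠ k in atTop, SignalExceeds (meanSignal (n k) (l k) σ₀ (Δ k))
      (varianceSignal (n k) (l k) (σ k / σ₀)) (noiseScale (l k)) (K * (1 + σ k / σ₀)) := by
  obtain ⟨c, hc, ⟨r, hr, hσr⟩, ho, habove⟩ := h
  have habove' : EventuallyAbove n l Δ fun k => σ₀ * detectionSlope c + ε k := habove
  refine eventually_signalExceeds_of_ratio hn hl hσ₀ hΔ (fun k => div_pos (hσ k) hσ₀) hc.le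
    (fun δ hδ => ?_) habove' (fun K hK => ?_) hK
  · filter_upwards [eventually_abs_le_of_isLittleO hr hε (δ := δ / (2 * c)) (by positivity),
      eventually_abs_le_of_isLittleO ho hε (δ := δ / (2 * c) * σ₀ ^ 2) (by positivity)] with k h1 h2
    have hΔk := hΔ k
    have hσk := hσ k
    rw [abs_of_nonneg (by positivity)] at h2
    have e : (σ k / σ₀) ^ 2 / (Δ k / σ₀) = c * (1 + r k) := by
      rw [div_pow, hσr k]
      field_simp
    have hr0 : 0 < c * (1 + r k) := by
      rw [← e]
      positivity
    have hr1 : 0 < 1 + r k := pos_of_mul_pos_right hr0 hc.le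
    rw [e, div_eq_mul_inv]
    set κ := σ k / σ₀ with hκ
    set v := (Real.sqrt (κ ^ 2 + 1))⁻¹ with hv
    have hv1 : v ≤ 1 := inv_le_one_of_one_le₀ (Real.one_le_sqrt.2 (by linarith [sq_nonneg κ]))
    have hv0 : 0 ≤ v := by positivity
    have hv2 : 1 - κ ^ 2 ≤ v := one_sub_sq_le_inv_sqrt κ
    have hκ2 : κ ^ 2 ≤ δ / (2 * c) * ε k := by
      rw [hκ, div_pow, div_le_iff₀ (by positivity)]
      linarith
    have hbd : |(1 + r k) * v - 1| ≤ |r k| + κ ^ 2 := by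
      have h3 := neg_abs_le (r k)
      have h4 := le_abs_self (r k)
      have h5 : 0 ≤ |r k| := abs_nonneg _
      rw [abs_le]
      constructor
      · nlinarith [mul_le_mul_of_nonneg_left hv1 h5, mul_le_mul_of_nonneg_right h3 hv0]
      · nlinarith [sq_nonneg κ]
    calc |c * (1 + r k) * v - c| = c * |(1 + r k) * v - 1| := by
          rw [← abs_of_pos hc, ← abs_mul, abs_of_pos hc]
          congr 1
          ring
      _ ≤ c * (δ / (2 * c) * ε k + δ / (2 * c) * ε k) := by
          gcongr
          linarith
      _ = δ * ε k := by
          field_simp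
          ring
  · filter_upwards [habove'.meanSignal hσ₀, hs.eventually_ge_atTop 1,
      eventually_abs_le_of_isLittleO ho hε (δ := σ₀) hσ₀,
      hεI.eventually_ge_atTop (σ₀ * (2 * K + 8 * K ^ 2))] with k h1 h2 h3 h4
    have hσk := hσ k
    have hεk := hε k
    set u := meanSignal (n k) (l k) σ₀ (Δ k)
    set s := noiseScale (l k)
    set κ := σ k / σ₀ with hκ
    rw [abs_of_nonneg (by positivity)] at h3
    have e1 : (σ₀ * detectionSlope c + ε k) / σ₀ * s =
      s * detectionSlope c + ε k * s / σ₀ := by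
      field_simp
    have hw' : 2 * K + 8 * K ^ 2 ≤ ε k * s / σ₀ := by
      rw [le_div_iff₀ hσ₀]
      linarith
    -- ε need not be bounded, so neither need κ; but σ² = o(ε) and s ≥ 1 keep κ² below the surplus.
    have hκw : κ ^ 2 ≤ ε k * s / σ₀ := by
      calc κ ^ 2 ≤ (σ₀ * ε k) / σ₀ ^ 2 := by rw [hκ, div_pow]; gcongr
        _ = ε k * 1 / σ₀ := by field_simp
        _ ≤ _ := by gcongr
    have h9 : 2 * (K * κ) ≤ 4 * K ^ 2 + κ ^ 2 / 4 := by nlinarith [sq_nonneg (2 * K - κ / 2)]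
    linarith [sq_nonneg K]

theorem DominantVariance.eventually_signalExceeds {n l : ℕ → ℕ} {σ₀ : ℝ} (hσ₀ : 0 < σ₀)
    {Δ σ ε : ℕ → ℝ} (hΔ : ∀ k, 0 < Δ k) (hσ : ∀ k, 0 < σ k) (hε : ∀ k, 0 < ε k)
    (hεI : Tendsto (fun k => ε k * noiseScale (l k)) atTop atTop)
    (h : DominantVariance n l σ₀ Δ σ ε) {K : ℝ} (hK : 0 < K) :
    ∀ᶠ k in atTop, SignalExceeds (meanSignal (n k) (l k) σ₀ (Δ k))
      (varianceSignal (n k) (l k) (σ k / σ₀)) (noiseScale (l k)) (K * (1 + σ k / σ₀)) := by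
  obtain ⟨θ, hθ, -, hσ0, -, ho, -, habove⟩ := h
  filter_upwards [habove.meanSignal hσ₀,
    hσ0.eventually_le_const (u := σ₀ / 2) (by positivity),
    eventually_abs_le_of_isLittleO ho hε (δ := σ₀ / 8) (by positivity),
    hεI.eventually_ge_atTop (σ₀ * (8 * K))] with k h1 h2 h3 h4
  have hΔk := hΔ k
  have hσk := hσ k
  have hεk := hε k
  have hs : 0 ≤ noiseScale (l k) := Real.sqrt_nonneg _
  have hθ0 : 0 < θ k := by
    have : 0 < σ k ^ 2 * θ k := by
      rw [← hθ k]
      positivity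
    exact pos_of_mul_pos_right this (by positivity)
  refine core_of_variance hs ?_
  set s := noiseScale (l k)
  set κ := σ k / σ₀ with hκ
  have hκ0 : 0 < κ := by positivity
  have hκ1 : κ ≤ 1 / 2 := by
    rw [hκ, div_le_iff₀ hσ₀]
    linarith
  set v := Real.sqrt (n k * intervalLength (l k)) * κ ^ 2 with hv
  have hb : varianceSignal (n k) (l k) κ = v * (Real.sqrt (κ ^ 2 + 1))⁻¹ := by
    rw [varianceSignal, div_eq_mul_inv]
  have hu : meanSignal (n k) (l k) σ₀ (Δ k) = v * θ k := by
    have e : Δ k / σ₀ = κ ^ 2 * θ k := by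
      rw [hκ, div_pow, div_mul_eq_mul_div, ← hθ k]
      field_simp
    rw [meanSignal, e, hv]
    ring
  set w := ε k * s / σ₀ with hw
  -- The mean signal is vθ, so dividing the hypothesis by θ turns it into a bound on the variance
  -- signal, up to the factor √(κ²+1).
  have hvw : (1 + Real.sqrt 3) * s + w ≤ v := by
    have e : ((1 + Real.sqrt 3) * σ₀ + ε k) * θ k / σ₀ * s =
        ((1 + Real.sqrt 3) * s + w) * θ k := by
      rw [hw]
      field_simp
    rw [e, hu] at h1
    exact le_of_mul_le_mul_right h1 hθ0
  have hw8 : 8 * K ≤ w := by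
    rw [hw, le_div_iff₀ hσ₀]
    linarith
  -- The factor 1/√(κ²+1) ≥ 1 - κ² costs a multiple of κ²s, which σ² = o(ε) makes a small part of
  -- the surplus w.
  have hκs : κ ^ 2 * s ≤ w / 8 := by
    rw [abs_of_nonneg (by positivity)] at h3
    calc κ ^ 2 * s ≤ (σ₀ / 8 * ε k) / σ₀ ^ 2 * s := by rw [hκ, div_pow]; gcongr
      _ = _ := by
        rw [hw]
        field_simp
  have h3' : Real.sqrt 3 ≤ 2 := by
    rw [Real.sqrt_le_iff]
    norm_num
  have hκsq : κ ^ 2 ≤ 1 / 4 := by nlinarith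
  have hw0 : 0 ≤ w := le_trans (by positivity) hw8
  have hlow : ((1 + Real.sqrt 3) * s + w) * (1 - κ ^ 2) ≤ v * (Real.sqrt (κ ^ 2 + 1))⁻¹ := by
    refine mul_le_mul hvw (one_sub_sq_le_inv_sqrt κ) (by linarith) (by positivity)
  rw [hb]
  refine le_trans ?_ hlow
  have h5 : (1 + Real.sqrt 3) * (κ ^ 2 * s) ≤ 3 * (w / 8) :=
    mul_le_mul (by linarith) hκs (by positivity) (by norm_num)
  have h6 : w * κ ^ 2 ≤ w * (1 / 4) := by gcongr
  have h7 : K * κ ≤ K * (1 / 2) := by gcongr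
  linarith

end HBR

theorem theorem5p4
    -- sample sizes `n k`, with `l k = 1 / |I|` candidate intervals, each of `n k / l k` points
    (n l : ℕ → ℕ) (hn : ∀ k, 0 < n k) (hl : ∀ k, 0 < l k) (hdvd : ∀ k, l k ∣ n k)
    (hI : Tendsto (fun k => HBR.intervalLength (l k)) atTop (𝓝 0))
    -- the parameters of the model
    (σ₀ : ℝ) (hσ₀ : 0 < σ₀)
    (Δ σ : ℕ → ℝ) (hΔ : ∀ k, 0 < Δ k) (hσ : ∀ k, 0 < σ k)
    (ε : ℕ → ℝ) (hε : ∀ k, 0 < ε k)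
    (hεI : Tendsto (fun k => ε k * Real.sqrt (-Real.log (HBR.intervalLength (l k))))
      atTop atTop)
    -- the level
    (α : ℝ) (hα : 0 < α) (hα1 : α ≤ 1)
    (hregime : HBR.DominantMean n l σ₀ Δ σ ε ∨ HBR.Equilibrium n l σ₀ Δ σ ε ∨
      HBR.DominantVariance n l σ₀ Δ σ ε) :
    limsup (fun k => HBR.typeIError (n k) σ₀
        (HBR.adaptiveTest (n k) (l k) σ₀ (σ k / σ₀) α)) atTop ≤ ENNReal.ofReal α ∧
    limsup (fun k => HBR.typeIIError (n k) (l k) (Δ k) σ₀ (σ k)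
        (HBR.adaptiveTest (n k) (l k) σ₀ (σ k / σ₀) α)) atTop ≤ ENNReal.ofReal α := by
  refine ⟨limsup_le_of_le (h := Eventually.of_forall fun k =>
    HBR.typeIError_adaptiveTest_le (hn k) (hl k) (hdvd k) hσ₀ hα hα1), limsup_le_of_le (h := ?_)⟩
  set w := Real.sqrt (-Real.log α) with hw
  have hw0 : 0 ≤ w := Real.sqrt_nonneg _
  have hK : 0 < 2 * (Real.sqrt 2 * w) + 3 + 4 * w + 2 * w ^ 2 := by positivity
  have hexceeds : ∀ᶠ k in atTop, HBR.SignalExceeds (HBR.meanSignal (n k) (l k) σ₀ (Δ k))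
      (HBR.varianceSignal (n k) (l k) (σ k / σ₀)) (HBR.noiseScale (l k))
      ((2 * (Real.sqrt 2 * w) + 3 + 4 * w + 2 * w ^ 2) * (1 + σ k / σ₀)) := by
    rcases hregime with h | h | h
    · exact h.eventually_signalExceeds hn hl hdvd hσ₀ hΔ hσ hε hεI hK
    · exact h.eventually_signalExceeds hn hl hσ₀ hΔ hσ hε (HBR.tendsto_noiseScale hl hI) hεI hK
    · exact h.eventually_signalExceeds hσ₀ hΔ hσ hε hεI hK
  filter_upwards [hexceeds] with k hk
  exact HBR.typeIIError_le_of_signalExceeds (hn k) (hl k) (hdvd k) hσ₀ (hΔ k) (hσ k) hα hα1 hw hk
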